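/- Let $K$ be a commutative non-Archimedean Banach ring (unital, complete, $\|ab\|\le\|a\|\,\|b\|$, $\|a+b\|\le\max\{\|a\|,\|b\|\}$) that is torsion free as an abelian group. A Banach $K$-module $V$ is a $K$-module complete for a non-Archimedean norm with $\|av\|\le\|a\|\,\|v\|$; ${\rm End}(V)$ is the Banach $K$-module of bounded $K$-linear operators on $V$ with the operator norm, and ${\rm End}(V)[[z^{\pm1}]]$, ${\rm End}(V)[[z^{\pm1},w^{\pm1}]]$ are the spaces of bilateral formal series with bounded coefficients, with the supremum norm. Write $a(z)=\sum_{n\in{\bf Z}}a_{(n)}z^{-n-1}$. A field is an $a(z)\in{\rm End}(V)[[z^{\pm1}]]$ with $a_{(n)}v\to0$ as $n\to+\infty$ for all $v\in V$. Fields $a,b$ are mutually local if $(z-w)^N[a(z),b(w)]\to0$ in norm as $N\to\infty$. Put $\partial_z^{(i)}\sum_n v_nz^n=\sum_n\binom{n}{i}v_nz^{n-i}$. The $n$-th product of fields is $a(w)_{(n)}b(w)={\rm Res}_z\big((z-w)^n[a(z),b(w)]\big)$ for $n\ge0$ and $a(z)_{(n)}b(z)={:}(\partial_z^{(m)}a(z))\,b(z){:}$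 for $n=-m-1<0$, where ${:}a(z)b(z){:}=a(z)_+b(z)+b(z)a(z)_-$ with $a(z)_+=\sum_{n\le-1}a_{(n)}z^{-n-1}$ and $a(z)_-=\sum_{n\ge0}a_{(n)}z^{-n-1}$. A vertex $K$-algebra consists of a Banach $K$-module $V$ that is torsion free both as an abelian group and as a $K$-module ($\lambda v=0$ implies $\lambda=0$ or $v=0$), a vector $|0\rangle\in V$, a bounded $K$-linear operator $T$ on $V$ with $T|0\rangle=0$, and a closed $K$-submodule ${\rm Fld}(V)$ of the space of fields that contains the identity $I_V$, such that: $\varphi_{(n)}|0\rangle=0$ for all $\varphi\in{\rm Fld}(V)$ and $n\ge0$; $[T,\varphi(z)]=\partial_z\varphi(z)$ for all $\varphi\in{\rm Fld}(V)$; any two elements of ${\rm Fld}(V)$ are mutually local; ${\rm Fld}(V)$ is preserved by all $n$-th products, $n\in{\bf Z}$; and for $V'=\{\varphi_{(-1)}|0\rangle:\varphi\in{\rm Fld}(V)\}$ the set $\{v\in V:\lambda v\in V'\text{ for some nonzero }\lambda\in K\}$ is dense in $V$. The map ${\rm Fld}(V)\to V'$, $\varphi\mapsto\varphi_{(-1)}|0\rangle$,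 is then bijective; its inverse is written $a\mapsto Y(a,z)=\sum_n a_{(n)}z^{-n-1}$, and $a_{(n)}b\in V'$ for all $a,b\in V'$. Then, for every vertex $K$-algebra $V$: (A) For all $a,b\in V'$ and $n\in{\bf Z}$, with $a(z)=Y(a,z)$ and $b(z)=Y(b,z)$, $$a(z)b(w)\,i_{z,w}\big((z-w)^n\big)-b(w)a(z)\,i_{w,z}\big((z-w)^n\big)=\sum_{j=0}^\infty Y(a_{(n+j)}b,w)\,\partial_w^{(j)}\delta(z-w),$$ where the sum converges in the norm of ${\rm End}(V)[[z^{\pm1},w^{\pm1}]]$. Here $i_{z,w}$ and $i_{w,z}$ denote the expansions in the domains $|z|>|w|$ and $|z|<|w|$, $\delta(z-w)=\sum_{n\in{\bf Z}}z^nw^{-n-1}$, and the coefficients of the products on the left are weakly (pointwise on $V$) convergent sums. (B) For all $a,b,c\in V'$ and $m,n,k\in{\bf Z}$, $$\sum_{j=0}^\infty\binom{m}{j}(a_{(n+j)}b)_{(m+k-j)}c=\sum_{j=0}^\infty(-1)^j\binom{n}{j}\Big(a_{(m+n-j)}(b_{(k+j)}c)-(-1)^n\,b_{(n+k-j)}(a_{(m+j)}c)\Big),$$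 both sums being convergent in $V'$ with the norm of $V$. (C) For all fields $a(z),b(z),c(z)\in{\rm Fld}(V)$ and $m,n,k\in{\bf Z}$, the identity of (B) holds with $a,b,c$ replaced by $a(z),b(z),c(z)$ and the operations by the $n$-th products of fields, both sums being convergent in the norm of ${\rm Fld}(V)$. -/

import Mathlib

open Filter Topology

noncomputable section

namespace NAVertex

/-! ## Bounded endomorphisms -/

section Basic

variable (K V : Type*) [NormedCommRing K] [NormedAddCommGroup V] [Module K V] [IsBoundedSMul K V]

/-- The module `End(V)` of all bounded `K`-linear operators `V → V`, i.e. the `K`-linear maps `f`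
with `‖f v‖ ≤ C * ‖v‖` for some constant `C`. Its norm is the infimum of such `C`'s. -/
def boundedEnd : Submodule K (NormedAddGroupHom V V) where
  carrier := {f | ∀ (c : K) (v : V), f (c • v) = c • f v}
  add_mem' := by
    intro f g hf hg c v
    simp only [Set.mem_ofPred_eq] at hf hg
    simp [hf, hg]
  zero_mem' := by
    intro c v
    simp
  smul_mem' := by
    intro d f hf c v
    simp only [Set.mem_ofPred_eq] at hf
    simp [hf, smul_comm c d]

/-- The type of bounded `K`-linear operators on `V`. -/
abbrev BddEnd : Type _ := ↥(boundedEnd K V)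

end Basic

section Basic2

variable {K V : Type*} [NormedCommRing K] [NormedAddCommGroup V] [Module K V] [IsBoundedSMul K V]

instance : FunLike (BddEnd K V) V V where
  coe f := f.1
  coe_injective := fun _ _ h => Subtype.ext (DFunLike.coe_injective h)

instance : AddMonoidHomClass (BddEnd K V) V V where
  map_add f := map_add f.1
  map_zero f := map_zero f.1

theorem BddEnd.map_smul' (f : BddEnd K V) (c : K) (v : V) : f (c • v) = c • f v := f.2 c v

theorem BddEnd.ext' {f g : BddEnd K V} (h : ∀ v, f v = g v) : f = g := DFunLike.ext f g h

@[simp] theorem BddEnd.add_apply (f g : BddEnd K V) (v : V) : (f + g) v = f v + g v := rfl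
@[simp] theorem BddEnd.sub_apply (f g : BddEnd K V) (v : V) : (f - g) v = f v - g v := rfl
@[simp] theorem BddEnd.neg_apply (f : BddEnd K V) (v : V) : (-f) v = -f v := rfl
@[simp] theorem BddEnd.zero_apply (v : V) : (0 : BddEnd K V) v = 0 := rfl
@[simp] theorem BddEnd.smul_apply (c : K) (f : BddEnd K V) (v : V) : (c • f) v = c • f v := rfl
@[simp] theorem BddEnd.zsmul_apply (c : ℤ) (f : BddEnd K V) (v : V) : (c • f) v = c • f v := rfl

theorem BddEnd.le_norm (f : BddEnd K V) (v : V) : ‖f v‖ ≤ ‖f‖ * ‖v‖ := f.1.le_opNorm v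

theorem BddEnd.norm_le {f : BddEnd K V} {C : ℝ} (hC : 0 ≤ C) (h : ∀ v, ‖f v‖ ≤ C * ‖v‖) :
    ‖f‖ ≤ C := f.1.opNorm_le_bound hC h

/-- A `K`-linear map with a bound, as an element of `End(V)`. -/
def BddEnd.mk' (f : V → V) (hadd : ∀ v w, f (v + w) = f v + f w)
    (hsmul : ∀ (c : K) v, f (c • v) = c • f v) (hb : ∃ C, ∀ v, ‖f v‖ ≤ C * ‖v‖) : BddEnd K V :=
  ⟨{ toFun := f, map_add' := hadd, bound' := hb }, hsmul⟩

@[simp] theorem BddEnd.mk'_apply (f : V → V) (hadd hsmul hb) (v : V) :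
    (BddEnd.mk' (K := K) f hadd hsmul hb) v = f v := rfl

/-- Composition of bounded operators. -/
def BddEnd.comp (f g : BddEnd K V) : BddEnd K V :=
  BddEnd.mk' (fun v => f (g v)) (by simp)
    (fun c v => by rw [BddEnd.map_smul', BddEnd.map_smul'])
    ⟨‖f‖ * ‖g‖, fun v => by
      rw [mul_assoc]
      exact (f.le_norm _).trans (mul_le_mul_of_nonneg_left (g.le_norm v) (norm_nonneg _))⟩

@[simp] theorem BddEnd.comp_apply (f g : BddEnd K V) (v : V) : f.comp g v = f (g v) := rfl

/-- The identity operator `I_V`. -/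
def BddEnd.id : BddEnd K V :=
  BddEnd.mk' (fun v => v) (fun _ _ => rfl) (fun _ _ => rfl) ⟨1, fun v => by simp⟩

@[simp] theorem BddEnd.id_apply (v : V) : (BddEnd.id : BddEnd K V) v = v := rfl

instance : IsBoundedSMul K (BddEnd K V) :=
  IsBoundedSMul.of_norm_smul_le fun c f =>
    BddEnd.norm_le (by positivity) fun v => by
      rw [BddEnd.smul_apply, mul_assoc]
      exact (norm_smul_le _ _).trans (mul_le_mul_of_nonneg_left (f.le_norm v) (norm_nonneg _))

end Basic2

/-! ## Formal distributions

`Dist K V` is the space `End(V)[[z^{±1}]]` with the supremum norm; `a : Dist K V` stands for the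
formal distribution `a(z) = ∑_{n ∈ ℤ} a_(n) z^{-n-1}` and `a n` is its coefficient `a_(n)`.
`Dist2 K V` is the space `End(V)[[z^{±1}, w^{±1}]]` with the supremum norm; `f : Dist2 K V` stands
for `∑_{m,k ∈ ℤ} f (m, k) z^{-m-1} w^{-k-1}`. -/

section Distributions

/-- Formal distributions `∑ a_(n) z^{-n-1}` in one variable with bounded coefficients. -/
abbrev Dist (K V : Type*) [NormedCommRing K] [NormedAddCommGroup V] [Module K V]
    [IsBoundedSMul K V] : Type _ := lp (fun _ : ℤ => BddEnd K V) ⊤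

/-- Formal distributions `∑ f_(m,k) z^{-m-1} w^{-k-1}` in two variables with bounded
coefficients. -/
abbrev Dist2 (K V : Type*) [NormedCommRing K] [NormedAddCommGroup V] [Module K V]
    [IsBoundedSMul K V] : Type _ := lp (fun _ : ℤ × ℤ => BddEnd K V) ⊤

variable {K V : Type*} [NormedCommRing K] [NormedAddCommGroup V] [Module K V] [IsBoundedSMul K V]

/-- A uniformly bounded family of operators, as an element of the corresponding space. -/
def mkDist {ι : Type*} (F : ι → BddEnd K V) (h : ∃ C, 0 ≤ C ∧ ∀ i v, ‖F i v‖ ≤ C * ‖v‖) :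
    lp (fun _ : ι => BddEnd K V) ⊤ :=
  ⟨F, memℓp_infty (by
    obtain ⟨C, hC, h⟩ := h
    exact ⟨C, by rintro _ ⟨i, rfl⟩; exact BddEnd.norm_le hC (h i)⟩)⟩

@[simp] theorem mkDist_apply {ι : Type*} (F : ι → BddEnd K V) (h) (i : ι) : mkDist F h i = F i :=
  rfl

theorem apply_le {ι : Type*} (f : lp (fun _ : ι => BddEnd K V) ⊤) (i : ι) (v : V) :
    ‖f i v‖ ≤ ‖f‖ * ‖v‖ :=
  ((f i).le_norm v).trans
    (mul_le_mul_of_nonneg_right (lp.norm_apply_le_norm ENNReal.top_ne_zero f i) (norm_nonneg _))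

theorem apply_apply_le {ι κ : Type*} (f : lp (fun _ : ι => BddEnd K V) ⊤)
    (g : lp (fun _ : κ => BddEnd K V) ⊤) (i : ι) (j : κ) (v : V) :
    ‖f i (g j v)‖ ≤ ‖f‖ * ‖g‖ * ‖v‖ := by
  rw [mul_assoc]
  exact (apply_le f i _).trans (mul_le_mul_of_nonneg_left (apply_le g j v) (norm_nonneg _))

/-- The commutator `[a(z), b(w)]`. -/
def commutator (a b : Dist K V) : Dist2 K V :=
  mkDist (fun mk => (a mk.1).comp (b mk.2) - (b mk.2).comp (a mk.1))
    ⟨‖a‖ * ‖b‖ + ‖b‖ * ‖a‖, by positivity, fun i v => by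
      rw [add_mul]
      exact (norm_sub_le _ _).trans
        (add_le_add (apply_apply_le a b _ _ v) (apply_apply_le b a _ _ v))⟩

/-- Multiplication by `z - w` on `End(V)[[z^{±1}, w^{±1}]]`. -/
def mulSub (f : Dist2 K V) : Dist2 K V :=
  mkDist (fun mk => f (mk.1 + 1, mk.2) - f (mk.1, mk.2 + 1))
    ⟨‖f‖ + ‖f‖, by positivity, fun i v => by
      rw [add_mul]
      exact (norm_sub_le _ _).trans (add_le_add (apply_le f _ v) (apply_le f _ v))⟩

/-- The residue `Res_z f(z,w)`, a formal distribution in `w`. -/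
def residue (f : Dist2 K V) : Dist K V :=
  mkDist (fun k => f (0, k)) ⟨‖f‖, norm_nonneg _, fun _ v => apply_le f _ v⟩

/-- Mutual locality: `(z-w)^N [a(z), b(w)] → 0` as `N → ∞`, in the norm of
`End(V)[[z^{±1}, w^{±1}]]`. -/
def MutuallyLocal (a b : Dist K V) : Prop :=
  Tendsto (fun N : ℕ => mulSub^[N] (commutator a b)) atTop (𝓝 0)

/-- The divided power derivation `∂_z^{(i)} : ∑ v_n z^n ↦ ∑ (n choose i) v_n z^{n-i}`; here the
coefficient of `z^{-k-1}` of the image comes from `n = i - k - 1`. -/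
def derivation [IsUltrametricDist V] (i : ℕ) (a : Dist K V) : Dist K V :=
  mkDist (fun k => Ring.choose ((i : ℤ) - k - 1) i • a (k - i))
    ⟨‖a‖, norm_nonneg _, fun _ v =>
      (IsUltrametricDist.norm_zsmul_le _ _).trans (apply_le a _ v)⟩

end Distributions

/-! ## Quantum fields -/

section Fields

variable (K V : Type*) [NormedCommRing K] [NormedAddCommGroup V] [Module K V] [IsBoundedSMul K V]

/-- The space `End(V)⟨⟨z⟩⟩` of quantum fields: `a_(n) v → 0` as `n → +∞` for every `v`. -/
def fields : Submodule K (Dist K V) where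
  carrier := {a | ∀ v : V, Tendsto (fun n : ℤ => a n v) atTop (𝓝 0)}
  add_mem' := by
    intro a b ha hb v
    simpa using (ha v).add (hb v)
  zero_mem' := by
    intro v
    simp
  smul_mem' := by
    intro c a ha v
    have h0 : Tendsto (fun n : ℤ => ‖c‖ * ‖a n v‖) atTop (𝓝 0) := by
      simpa using (ha v).norm.const_mul ‖c‖
    exact squeeze_zero_norm (fun n => norm_smul_le c (a n v)) h0

/-- The type of quantum fields. -/
abbrev QField : Type _ := ↥(fields K V)

variable {K V}

/-- The identity field `I_V = I_V z^0`. -/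
def idField : QField K V :=
  ⟨mkDist (fun n => if n = -1 then BddEnd.id else 0) ⟨1, zero_le_one, fun n v => by
    split_ifs <;> simp⟩, fun v => by
    refine tendsto_const_nhds.congr' ?_
    filter_upwards [eventually_ge_atTop (0 : ℤ)] with n hn
    have : n ≠ -1 := by omega
    simp [this]⟩

theorem QField.tendsto_nat_add (a : QField K V) (p : ℤ) (v : V) :
    Tendsto (fun j : ℕ => a.1 (p + j) v) atTop (𝓝 0) :=
  (a.2 v).comp (tendsto_atTop_add_const_left _ p tendsto_natCast_atTop_atTop)

theorem tendsto_apply_zero {ι κ : Type*} {l : Filter κ} (f : lp (fun _ : ι => BddEnd K V) ⊤)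
    (i : κ → ι) {x : κ → V} (hx : Tendsto x l (𝓝 0)) :
    Tendsto (fun j => f (i j) (x j)) l (𝓝 0) :=
  squeeze_zero_norm (fun j => apply_le f (i j) (x j)) (by simpa using hx.norm.const_mul ‖f‖)

variable [IsUltrametricDist V]

/-- The derivations `∂_z^{(i)}` preserve fields. -/
def QField.derivation (i : ℕ) (a : QField K V) : QField K V :=
  ⟨NAVertex.derivation i a.1, fun v => by
    have h : Tendsto (fun n : ℤ => a.1 (n - i) v) atTop (𝓝 0) :=
      (a.2 v).comp (tendsto_atTop_add_const_right _ (-(i : ℤ)) tendsto_id)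
    exact squeeze_zero_norm (fun n => IsUltrametricDist.norm_zsmul_le _ _)
      (by have h2 := h.norm; rwa [norm_zero] at h2)⟩

/-- The sum of a uniformly bounded, pointwise summable family of operators:
`v ↦ ∑ i, F i v` (convergence in the weak topology). -/
def weakSum {ι : Type*} (F : ι → BddEnd K V) (hb : ∃ C, 0 ≤ C ∧ ∀ i v, ‖F i v‖ ≤ C * ‖v‖)
    (hs : ∀ v, Summable fun i => F i v) : BddEnd K V :=
  BddEnd.mk' (fun v => ∑' i, F i v)
    (fun v w => by simp only [map_add]; exact (hs v).tsum_add (hs w))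
    (fun c v => by
      simp only [BddEnd.map_smul']
      exact (((hs v).hasSum.map (DistribSMul.toAddMonoidHom V c)
        (continuous_const_smul c))).tsum_eq)
    (by
      obtain ⟨C, hC, h⟩ := hb
      exact ⟨C, fun v => IsUltrametricDist.norm_tsum_le_of_forall_le_of_nonneg
        (mul_nonneg hC (norm_nonneg v)) (fun i => h i v)⟩)

@[simp] theorem weakSum_apply {ι : Type*} (F : ι → BddEnd K V) (hb hs) (v : V) :
    weakSum F hb hs v = ∑' i, F i v := rfl

theorem weakSum_bound {ι : Type*} (F : ι → BddEnd K V) (hb hs) {C : ℝ} (hC : 0 ≤ C) (v : V)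
    (h : ∀ i, ‖F i v‖ ≤ C) : ‖weakSum F hb hs v‖ ≤ C :=
  IsUltrametricDist.norm_tsum_le_of_forall_le_of_nonneg hC h

variable [CompleteSpace V]

theorem summable_of_ray {ι : Type*} {e : ℕ → ι} (he : Function.Injective e) {G : ι → V}
    (h0 : ∀ x ∉ Set.range e, G x = 0) (ht : Tendsto (fun j => G (e j)) atTop (𝓝 0)) :
    Summable G := by
  rw [← he.summable_iff h0]
  apply NonarchimedeanAddGroup.summable_of_tendsto_cofinite_zero
  rwa [Nat.cofinite_eq_atTop]

theorem summable_nat {G : ℕ → V} (ht : Tendsto G atTop (𝓝 0)) : Summable G :=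
  summable_of_ray (e := fun j => j) Function.injective_id (fun x hx => (hx ⟨x, rfl⟩).elim) ht

/-- The coefficient of `z^{-p-1}` of `a(z)_+ b(z)`, where `a(z)_+ = ∑_{n ≤ -1} a_(n) z^{-n-1}`:
the sum of `a_(m) b_(n)` over all `m ≤ -1` and `n` with `m + n = p - 1`; write `m = -1 - i`. -/
def plusCoeff (a b : QField K V) (p : ℤ) : BddEnd K V :=
  weakSum (fun i : ℕ => (a.1 (-1 - i)).comp (b.1 (p + i)))
    ⟨‖a‖ * ‖b‖, by positivity, fun _ v => apply_apply_le a.1 b.1 _ _ v⟩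
    (fun v => summable_nat (tendsto_apply_zero a.1 _ (b.tendsto_nat_add p v)))

/-- The coefficient of `z^{-p-1}` of `b(z) a(z)_-`, where `a(z)_- = ∑_{n ≥ 0} a_(n) z^{-n-1}`:
the sum of `b_(n) a_(i)` over all `i ≥ 0` and `n` with `i + n = p - 1`. -/
def minusCoeff (a b : QField K V) (p : ℤ) : BddEnd K V :=
  weakSum (fun i : ℕ => (b.1 (p - 1 - i)).comp (a.1 i))
    ⟨‖b‖ * ‖a‖, by positivity, fun _ v => apply_apply_le b.1 a.1 _ _ v⟩
    (fun v => summable_nat (tendsto_apply_zero b.1 _ (by simpa using a.tendsto_nat_add 0 v)))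

theorem plusCoeff_tendsto (a b : QField K V) (v : V) :
    Tendsto (fun p => plusCoeff a b p v) atTop (𝓝 0) := by
  rw [Metric.tendsto_atTop]
  intro ε hε
  have hb := (Metric.tendsto_atTop.1 (b.2 v)) (ε / 2 / (‖a‖ + 1)) (by positivity)
  obtain ⟨N, hN⟩ := hb
  refine ⟨N, fun p hp => ?_⟩
  rw [dist_zero_right]
  refine lt_of_le_of_lt (weakSum_bound _ _ _ (C := ε / 2) (by positivity) v fun i => ?_)
    (half_lt_self hε)
  have h1 := hN (p + i) (by omega)
  rw [dist_zero_right] at h1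
  calc ‖a.1 (-1 - i) (b.1 (p + i) v)‖ ≤ ‖a‖ * ‖b.1 (p + i) v‖ := apply_le a.1 _ _
    _ ≤ (‖a‖ + 1) * (ε / 2 / (‖a‖ + 1)) := by gcongr; linarith
    _ = ε / 2 := by field_simp

theorem minusCoeff_tendsto (a b : QField K V) (v : V) :
    Tendsto (fun p => minusCoeff a b p v) atTop (𝓝 0) := by
  rw [Metric.tendsto_atTop]
  intro ε hε
  obtain ⟨N, hN⟩ := (Metric.tendsto_atTop.1 (a.2 v)) (ε / 2 / (‖b‖ + 1)) (by positivity)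
  have hfin : ∀ i : ℕ, ∀ᶠ p : ℤ in atTop, ‖b.1 (p - 1 - i) (a.1 i v)‖ < ε / 2 := by
    intro i
    have h : Tendsto (fun p : ℤ => b.1 (p - 1 - i) (a.1 i v)) atTop (𝓝 0) := by
      refine ((b.2 (a.1 i v)).comp
        (tendsto_atTop_add_const_right _ (-1 - (i : ℤ)) tendsto_id)).congr fun p => ?_
      simp only [Function.comp, id]
      rw [show p + (-1 - (i : ℤ)) = p - 1 - i by ring]
    have h2 := h.norm
    rw [norm_zero] at h2
    exact h2.eventually_lt_const (by positivity)
  have hall : ∀ᶠ p : ℤ in atTop, ∀ i ∈ Finset.range N.toNat,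
      ‖b.1 (p - 1 - i) (a.1 i v)‖ < ε / 2 :=
    (Finset.eventually_all _).2 fun i _ => hfin i
  obtain ⟨P, hP⟩ := eventually_atTop.1 hall
  refine ⟨P, fun p hp => ?_⟩
  rw [dist_zero_right]
  refine lt_of_le_of_lt (weakSum_bound _ _ _ (C := ε / 2) (by positivity) v fun i => ?_)
    (half_lt_self hε)
  by_cases hi : i < N.toNat
  · exact (hP p hp i (Finset.mem_range.2 hi)).le
  · have h1 := hN i (by omega)
    rw [dist_zero_right] at h1
    calc ‖b.1 (p - 1 - i) (a.1 i v)‖ ≤ ‖b‖ * ‖a.1 i v‖ := apply_le b.1 _ _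
      _ ≤ (‖b‖ + 1) * (ε / 2 / (‖b‖ + 1)) := by gcongr; linarith
      _ = ε / 2 := by field_simp

/-- The normally ordered product `:a(z)b(z): = a(z)_+ b(z) + b(z) a(z)_-`. -/
def normalProd (a b : QField K V) : QField K V :=
  ⟨mkDist (fun p => plusCoeff a b p + minusCoeff a b p)
    ⟨‖a‖ * ‖b‖ + ‖b‖ * ‖a‖, by positivity, fun p v => by
      rw [add_mul]
      exact (norm_add_le _ _).trans (add_le_add
        (weakSum_bound _ _ _ (by positivity) v fun _ => apply_apply_le a.1 b.1 _ _ v)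
        (weakSum_bound _ _ _ (by positivity) v fun _ => apply_apply_le b.1 a.1 _ _ v))⟩,
    fun v => by simpa using (plusCoeff_tendsto a b v).add (minusCoeff_tendsto a b v)⟩

theorem iterate_mulSub_commutator_tendsto (a b : QField K V) (n : ℕ) (m : ℤ) (v : V) :
    Tendsto (fun k : ℤ => mulSub^[n] (commutator a.1 b.1) (m, k) v) atTop (𝓝 0) := by
  induction n generalizing m with
  | zero =>
    have h1 : Tendsto (fun k : ℤ => a.1 m (b.1 k v)) atTop (𝓝 0) :=
      tendsto_apply_zero a.1 (fun _ => m) (b.2 v)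
    simpa [commutator] using h1.sub (b.2 (a.1 m v))
  | succ n ih =>
    simp only [Function.iterate_succ', Function.comp]
    have h1 : Tendsto (fun k : ℤ => mulSub^[n] (commutator a.1 b.1) (m, k + 1) v) atTop (𝓝 0) :=
      (ih m).comp (tendsto_atTop_add_const_right _ (1 : ℤ) tendsto_id)
    simpa [mulSub] using (ih (m + 1)).sub h1

/-- The `n`-th product `a(z)_(n) b(z)` of fields: `Res_z ((z-w)^n [a(z), b(w)])` for `n ≥ 0`, and
`:(∂_z^{(m)} a(z)) b(z):` for `n = -m-1 < 0`. -/
def nthProd : ℤ → QField K V → QField K V → QField K V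
  | Int.ofNat n, a, b => ⟨residue (mulSub^[n] (commutator a.1 b.1)),
      fun v => iterate_mulSub_commutator_tendsto a b n 0 v⟩
  | Int.negSucc m, a, b => normalProd (a.derivation m) b

end Fields

/-! ## Integral formal series in two variables and their products with fields

A function `s : ℤ × ℤ → ℤ` stands for the formal series `∑ s (p, q) z^p w^q`. -/

section Series

/-- `i_{z,w}((z-w)^n) = ∑_{j ≥ 0} (n choose j) z^{n-j} (-w)^j`, the expansion of `(z-w)^n` in the
domain `|z| > |w|`. -/
def expandZW (n : ℤ) : ℤ × ℤ → ℤ := fun pq =>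
  if 0 ≤ pq.2 ∧ pq.1 + pq.2 = n then (-1) ^ pq.2.toNat * Ring.choose n pq.2.toNat else 0

/-- `i_{w,z}((z-w)^n) = ∑_{j ≥ 0} (n choose j) z^j (-w)^{n-j}`, the expansion of `(z-w)^n` in the
domain `|z| < |w|`. -/
def expandWZ (n : ℤ) : ℤ × ℤ → ℤ := fun pq =>
  if 0 ≤ pq.1 ∧ pq.1 + pq.2 = n then (Int.negOnePow pq.2 : ℤ) * Ring.choose n pq.1.toNat else 0

/-- The formal delta-function `δ(z-w) = ∑_{n ∈ ℤ} z^n w^{-n-1}`. -/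
def delta : ℤ × ℤ → ℤ := fun pq => if pq.1 + pq.2 = -1 then 1 else 0

/-- The divided power derivation `∂_w^{(j)}`. -/
def derivW (j : ℕ) (s : ℤ × ℤ → ℤ) : ℤ × ℤ → ℤ :=
  fun pq => Ring.choose (pq.2 + j) j * s (pq.1, pq.2 + j)

variable {K V : Type*} [NormedCommRing K] [NormedAddCommGroup V] [Module K V] [IsBoundedSMul K V]
  [IsUltrametricDist V]

theorem norm_finsum_zsmul_le (g : Dist K V) (c : ℤ → ℤ) (k : ℤ) :
    ‖∑ᶠ q : ℤ, c q • g (k + q)‖ ≤ ‖g‖ := by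
  refine BddEnd.norm_le (norm_nonneg _) fun v => ?_
  by_cases h : (Function.support fun q : ℤ => c q • g (k + q)).Finite
  · rw [finsum_eq_sum _ h]
    have : ∀ s : Finset ℤ, ‖(∑ q ∈ s, c q • g (k + q)) v‖ ≤ ‖g‖ * ‖v‖ := by
      intro s
      induction s using Finset.induction_on with
      | empty => simpa using by positivity
      | insert q s hq ih =>
        rw [Finset.sum_insert hq, BddEnd.add_apply]
        exact (IsUltrametricDist.norm_add_le_max _ _).trans (max_le
          ((IsUltrametricDist.norm_zsmul_le _ _).trans (apply_le g _ v)) ih)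
    exact this _
  · rw [finsum_of_infinite_support h]
    simpa using by positivity

/-- The product `g(w) s(z,w)`, for series `s` with finitely many `w`-powers at each `z`-power: the
coefficient of `z^{-m-1} w^{-k-1}` is the sum of `s_{-m-1,q} g_(k+q)` over all `q`. -/
def mulSeries (g : Dist K V) (s : ℤ × ℤ → ℤ) : Dist2 K V :=
  mkDist (fun mk => ∑ᶠ q : ℤ, s (-mk.1 - 1, q) • g (mk.2 + q))
    ⟨‖g‖, norm_nonneg _, fun mk v => (BddEnd.le_norm _ v).trans
      (mul_le_mul_of_nonneg_right
        (norm_finsum_zsmul_le g (fun q => s (-mk.1 - 1, q)) mk.2) (norm_nonneg v))⟩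

variable [CompleteSpace V]

/-- The product `a(z) b(w) i_{z,w}((z-w)^n)`: the coefficient of `z^{-m-1} w^{-k-1}` is the (weakly
convergent) sum of `s_{p,q} a_(m+p) b_(k+q)` over all `(p,q)`, where `s = i_{z,w}((z-w)^n)`. -/
def prodZW (a b : QField K V) (n : ℤ) : Dist2 K V :=
  mkDist (fun mk => weakSum
      (fun pq : ℤ × ℤ => expandZW n pq • (a.1 (mk.1 + pq.1)).comp (b.1 (mk.2 + pq.2)))
      ⟨‖a‖ * ‖b‖, by positivity, fun _ v =>
        (IsUltrametricDist.norm_zsmul_le _ _).trans (apply_apply_le a.1 b.1 _ _ v)⟩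
      (fun v => summable_of_ray (e := fun j : ℕ => (n - j, (j : ℤ)))
        (fun i j h => by simpa using (Prod.ext_iff.1 h).2)
        (by
          rintro ⟨p, q⟩ hx
          have : ¬ (0 ≤ q ∧ p + q = n) := by
            rintro ⟨h1, h2⟩
            exact hx ⟨q.toNat, Prod.ext (by simp; omega) (by simp; omega)⟩
          simp [expandZW, this])
        (squeeze_zero_norm (fun j => IsUltrametricDist.norm_zsmul_le _ _) (by
          have h2 := (tendsto_apply_zero a.1 (fun j : ℕ => mk.1 + (n - j))
            (b.tendsto_nat_add mk.2 v)).norm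
          rwa [norm_zero] at h2))))
    ⟨‖a‖ * ‖b‖, by positivity, fun _ v => weakSum_bound _ _ _ (by positivity) v fun _ =>
      (IsUltrametricDist.norm_zsmul_le _ _).trans (apply_apply_le a.1 b.1 _ _ v)⟩

/-- The product `b(w) a(z) i_{w,z}((z-w)^n)`: the coefficient of `z^{-m-1} w^{-k-1}` is the (weakly
convergent) sum of `s_{p,q} b_(k+q) a_(m+p)` over all `(p,q)`, where `s = i_{w,z}((z-w)^n)`. -/
def prodWZ (a b : QField K V) (n : ℤ) : Dist2 K V :=
  mkDist (fun mk => weakSum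
      (fun pq : ℤ × ℤ => expandWZ n pq • (b.1 (mk.2 + pq.2)).comp (a.1 (mk.1 + pq.1)))
      ⟨‖b‖ * ‖a‖, by positivity, fun _ v =>
        (IsUltrametricDist.norm_zsmul_le _ _).trans (apply_apply_le b.1 a.1 _ _ v)⟩
      (fun v => summable_of_ray (e := fun j : ℕ => ((j : ℤ), n - j))
        (fun i j h => by simpa using (Prod.ext_iff.1 h).1)
        (by
          rintro ⟨p, q⟩ hx
          have : ¬ (0 ≤ p ∧ p + q = n) := by
            rintro ⟨h1, h2⟩
            exact hx ⟨p.toNat, Prod.ext (by simp; omega) (by simp; omega)⟩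
          simp [expandWZ, this])
        (squeeze_zero_norm (fun j => IsUltrametricDist.norm_zsmul_le _ _) (by
          have h2 := (tendsto_apply_zero b.1 (fun j : ℕ => mk.2 + (n - j))
            (a.tendsto_nat_add mk.1 v)).norm
          rwa [norm_zero] at h2))))
    ⟨‖b‖ * ‖a‖, by positivity, fun _ v => weakSum_bound _ _ _ (by positivity) v fun _ =>
      (IsUltrametricDist.norm_zsmul_le _ _).trans (apply_apply_le b.1 a.1 _ _ v)⟩

end Series

/-! ## Vertex algebras -/

section Vertex

/-- A vertex `K`-algebra with space of states `V`. -/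
structure VertexAlgebra (K V : Type*) [NormedCommRing K] [NormedAddCommGroup V] [Module K V]
    [IsBoundedSMul K V] [IsUltrametricDist V] [CompleteSpace V] where
  /-- `V` is a torsion free `K`-module -/
  torsionFree : ∀ (c : K) (v : V), c • v = 0 → c = 0 ∨ v = 0
  /-- the vacuum vector `|0⟩` -/
  vac : V
  /-- the translation operator -/
  T : BddEnd K V
  T_vac : T vac = 0
  /-- the space of fields `Fld(V)`, a closed submodule containing `I_V` -/
  Fld : Submodule K (QField K V)
  isClosed_Fld : IsClosed (Fld : Set (QField K V))
  idField_mem : idField ∈ Fld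
  /-- `φ(z)|0⟩ ∈ V[[z]]` -/
  vacuum : ∀ φ ∈ Fld, ∀ n : ℤ, 0 ≤ n → φ.1 n vac = 0
  /-- `[T, φ(z)] = ∂_z φ(z)` -/
  translation : ∀ φ ∈ Fld, ∀ n : ℤ,
    T.comp (φ.1 n) - (φ.1 n).comp T = derivation 1 φ.1 n
  locality : ∀ φ ∈ Fld, ∀ ψ ∈ Fld, MutuallyLocal φ.1 ψ.1
  nthProd_mem : ∀ φ ∈ Fld, ∀ ψ ∈ Fld, ∀ n : ℤ, nthProd n φ ψ ∈ Fld
  /-- the `K`-saturation of `V' = {φ_(-1)|0⟩ | φ ∈ Fld(V)}` is dense in `V` -/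
  dense_saturation : Dense {v : V | ∃ c : K, c ≠ 0 ∧ ∃ φ ∈ Fld, φ.1 (-1) vac = c • v}

variable {K V : Type*} [NormedCommRing K] [NormedAddCommGroup V] [Module K V] [IsBoundedSMul K V]

theorem iterate_mulSub_vac (a b : Dist K V) (v : V) (M : ℤ) (ha : ∀ m, M ≤ m → a m v = 0)
    (hb : ∀ k, 0 ≤ k → b k v = 0) (N : ℕ) : ∀ m, M ≤ m →
      (∀ k, 0 ≤ k → mulSub^[N] (commutator a b) (m, k) v = 0) ∧
        mulSub^[N] (commutator a b) (m, -1) v = a (m + N) (b (-1) v) := by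
  induction N with
  | zero =>
    intro m hm
    refine ⟨fun k hk => ?_, ?_⟩ <;> simp [commutator, ha m hm]
    simp [hb k hk]
  | succ N ih =>
    intro m hm
    simp only [Function.iterate_succ', Function.comp]
    refine ⟨fun k hk => ?_, ?_⟩
    · simp [mulSub, (ih m hm).1 (k + 1) (by omega), (ih (m + 1) (by omega)).1 k hk]
    · have h0 := (ih m hm).1 0 le_rfl
      have h1 := (ih (m + 1) (by omega)).2
      simp only [mulSub, mkDist_apply, BddEnd.sub_apply]
      rw [h1, show (-1 : ℤ) + 1 = 0 by norm_num, h0, sub_zero]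
      congr 2
      push_cast
      ring_nf

variable [IsUltrametricDist V] [CompleteSpace V]

theorem nthProd_vac (a b : QField K V) (v : V) (ha : ∀ m, 0 ≤ m → a.1 m v = 0)
    (hb : ∀ k, 0 ≤ k → b.1 k v = 0) (n : ℤ) :
    (nthProd n a b).1 (-1) v = a.1 n (b.1 (-1) v) := by
  cases n with
  | ofNat n =>
    have h := (iterate_mulSub_vac a.1 b.1 v 0 ha hb n 0 le_rfl).2
    rw [zero_add] at h
    exact h
  | negSucc m =>
    have h1 : plusCoeff (a.derivation m) b (-1) v = a.1 (Int.negSucc m) (b.1 (-1) v) := by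
      simp only [plusCoeff, weakSum_apply, BddEnd.comp_apply]
      rw [tsum_eq_single 0]
      · simp only [QField.derivation, derivation, mkDist_apply]
        have e1 : (m : ℤ) - (-1 - ((0 : ℕ) : ℤ)) - 1 = ((m : ℕ) : ℤ) := by simp
        have e2 : (-1 - ((0 : ℕ) : ℤ)) - m = Int.negSucc m := by
          rw [Int.negSucc_eq]; push_cast; ring
        rw [e1, e2, Ring.choose_natCast]
        simp
      · intro i hi
        rw [hb (-1 + i) (by omega), map_zero]
    have h2 : minusCoeff (a.derivation m) b (-1) v = 0 := by
      simp only [minusCoeff, weakSum_apply, BddEnd.comp_apply]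
      have : ∀ i : ℕ, (a.derivation m).1 (i : ℤ) v = 0 := by
        intro i
        simp only [QField.derivation, derivation, mkDist_apply, BddEnd.zsmul_apply]
        by_cases him : m ≤ i
        · rw [ha _ (by omega), smul_zero]
        · have e1 : (m : ℤ) - i - 1 = ((m - i - 1 : ℕ) : ℤ) := by omega
          rw [e1, Ring.choose_natCast, Nat.choose_eq_zero_of_lt (by omega)]
          simp
      simp [this]
    change (plusCoeff (a.derivation m) b (-1) + minusCoeff (a.derivation m) b (-1)) v = _
    rw [BddEnd.add_apply, h1, h2, add_zero]

namespace VertexAlgebra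

variable (A : VertexAlgebra K V)

/-- The field-state homomorphism `fs : φ(z) ↦ φ_(-1)|0⟩`. -/
def fs : A.Fld →ₗ[K] V where
  toFun φ := φ.1.1 (-1) A.vac
  map_add' _ _ := rfl
  map_smul' _ _ := rfl

/-- The image `V'` of the field-state homomorphism. -/
def stateImage : Submodule K V := LinearMap.range A.fs

theorem apply_vac_eq_zero [IsAddTorsionFree V] {φ : QField K V} (hφ : φ ∈ A.Fld)
    (h : φ.1 (-1) A.vac = 0) (n : ℤ) : φ.1 n A.vac = 0 := by
  have key : ∀ j : ℕ, φ.1 (-1 - j) A.vac = 0 := by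
    intro j
    induction j with
    | zero => simpa using h
    | succ j ih =>
      have ht := congrArg (fun f : BddEnd K V => f A.vac) (A.translation φ hφ (-1 - j))
      simp only [derivation, mkDist_apply, BddEnd.sub_apply, BddEnd.comp_apply, ih, map_zero,
        A.T_vac, BddEnd.zsmul_apply, Ring.choose_one_right, sub_zero] at ht
      rw [eq_comm, smul_eq_zero] at ht
      rcases ht with ht | ht
      · push_cast at ht
        omega
      · rw [← ht]
        congr 2
        push_cast
        ring_nf
  rcases le_or_gt 0 n with hn | hn
  · exact A.vacuum φ hφ n hn
  · have e : n = -1 - ((-1 - n).toNat : ℤ) := by omega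
    rw [e]
    exact key _

/-- The field-state homomorphism is injective. -/
theorem fs_injective [IsAddTorsionFree V] : Function.Injective A.fs := by
  rw [injective_iff_map_eq_zero]
  rintro ⟨φ, hφ⟩ h
  have hz := A.apply_vac_eq_zero hφ h
  have h1 : ∀ ψ ∈ A.Fld, ∀ m, φ.1 m (ψ.1 (-1) A.vac) = 0 := by
    intro ψ hψ m
    have hlim : Tendsto (fun N : ℕ => ‖mulSub^[N] (commutator φ.1 ψ.1)‖ * ‖A.vac‖) atTop (𝓝 0) := by
      simpa using (A.locality φ hφ ψ hψ).norm.mul_const ‖A.vac‖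
    have hle : ∀ N : ℕ, ‖φ.1 m (ψ.1 (-1) A.vac)‖ ≤
        ‖mulSub^[N] (commutator φ.1 ψ.1)‖ * ‖A.vac‖ := by
      intro N
      have h2 := (iterate_mulSub_vac φ.1 ψ.1 A.vac (m - N) (fun k _ => hz k)
        (A.vacuum ψ hψ) N (m - N) le_rfl).2
      rw [sub_add_cancel] at h2
      rw [← h2]
      exact apply_le _ _ _
    exact norm_le_zero_iff.1 (ge_of_tendsto' hlim hle)
  have h2 : ∀ m v, φ.1 m v = 0 := by
    intro m
    have hc : Continuous fun v => φ.1 m v := map_continuous (φ.1 m).1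
    have := hc.ext_on A.dense_saturation (continuous_const (y := (0 : V))) (by
      rintro v ⟨c, hc0, ψ, hψ, hv⟩
      have h3 := h1 ψ hψ m
      rw [hv, BddEnd.map_smul'] at h3
      exact (A.torsionFree c _ h3).resolve_left hc0)
    exact fun v => congrFun this v
  exact Subtype.ext (Subtype.ext (lp.ext (funext fun m => BddEnd.ext' (h2 m))))

/-- The state-field correspondence `a ↦ Y(a,z)`, the inverse of the field-state homomorphism. -/
def Y [IsAddTorsionFree V] : A.stateImage ≃ₗ[K] A.Fld :=
  (LinearEquiv.ofInjective A.fs A.fs_injective).symm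

theorem Y_vac [IsAddTorsionFree V] (a : A.stateImage) : (A.Y a).1.1 (-1) A.vac = a :=
  congrArg Subtype.val ((LinearEquiv.ofInjective A.fs A.fs_injective).apply_symm_apply a)

/-- The `n`-th product on `Fld(V)`. -/
def fieldProd (n : ℤ) (φ ψ : A.Fld) : A.Fld := ⟨nthProd n φ.1 ψ.1, A.nthProd_mem _ φ.2 _ ψ.2 n⟩

/-- The operation `(a, b) ↦ a_(n) b` on `V'`, where `Y(a,z) = ∑ a_(n) z^{-n-1}`. -/
def stateProd [IsAddTorsionFree V] (n : ℤ) (a b : A.stateImage) : A.stateImage :=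
  ⟨(A.Y a).1.1 n b, A.fieldProd n (A.Y a) (A.Y b), by
    have h := nthProd_vac (A.Y a).1 (A.Y b).1 A.vac (A.vacuum _ (A.Y a).2)
      (A.vacuum _ (A.Y b).2) n
    rw [A.Y_vac] at h
    exact h⟩

end VertexAlgebra

end Vertex

end NAVertex

end

open NAVertex

/-!
For fields `a`, `b` and any integer `n` put
`G_n = a(z) b(w) i_{z,w}((z-w)^n) - b(w) a(z) i_{w,z}((z-w)^n)` (`shiftedCommutator`). By Pascal's
rule `(z-w) G_n = G_{n+1}`, and `G_0 = [a(z), b(w)]`, so locality says that `G_n → 0` in norm as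
`n → ∞`. A comparison of coefficients gives `Res_z G_n = a(w)_(n) b(w)` for all integers `n`,
positive or negative (`nthProd_eq_residue`).

The core is the decomposition theorem `hasSum_mulSeries_residue`: if `(z-w)^N f → 0`, then
`f = ∑_j (Res_z (z-w)^j f)(w) ∂_w^{(j)} δ(z-w)` in norm. It follows from the estimate
`norm_le_of_residue_le`: the norm of a distribution is at most the maximum of the norms of
`(z-w)^M f` and of the residues `Res_z (z-w)^j f`, `j < M`. When `f` is replaced by its difference
from a partial sum, `(z-w)^M f` does not change for large `M`, the residues whose indices occur in
the partial sum vanish, and the others do not change, hence are small. Applied to `f = G_n`, this is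
the operator product expansion `hasSum_operatorProduct`, valid for all pairs of mutually local
fields.

For the Borcherds identity, `‖a_(n) b‖ ≤ ‖a‖ ‖b‖` (`norm_nthProd_le`) and locality make the terms of
both sums tend to zero in `Fld(V)`, where null sequences are summable. The two limits are compared
through the injective field-state map, which sends them to the same vector: a coefficient of the
operator product expansion, applied to a state, written once as a sum of products and once as a
difference of two expansions. The identity for states is the image of the one for fields. Its sums
therefore converge within `V'`, although `V'` need not be closed in `V`.
-/

namespace NAVertex

/-! ### Ultrametric norms on operators, distributions and fields -/

section Norms

variable {K V : Type*} [NormedCommRing K] [NormedAddCommGroup V] [Module K V] [IsBoundedSMul K V]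

theorem norm_le_of_apply_le {ι : Type*} {f : lp (fun _ : ι => BddEnd K V) ⊤} {C : ℝ} (hC : 0 ≤ C)
    (h : ∀ i v, ‖f i v‖ ≤ C * ‖v‖) : ‖f‖ ≤ C :=
  lp.norm_le_of_forall_le hC fun i => BddEnd.norm_le hC (h i)

theorem dist_ext {ι : Type*} {f g : lp (fun _ : ι => BddEnd K V) ⊤} (h : ∀ i v, f i v = g i v) :
    f = g :=
  lp.ext (funext fun i => BddEnd.ext' (h i))

/-- Evaluation of a coefficient of a formal distribution at a vector. -/
noncomputable def evalHom {ι : Type*} (i : ι) (v : V) : lp (fun _ : ι => BddEnd K V) ⊤ →+ V where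
  toFun f := f i v
  map_zero' := rfl
  map_add' _ _ := rfl

theorem continuous_evalHom {ι : Type*} (i : ι) (v : V) :
    Continuous (evalHom (K := K) i v) :=
  AddMonoidHomClass.continuous_of_bound _ ‖v‖ fun f => by
    rw [mul_comm]; exact apply_le f i v

variable [IsUltrametricDist V]

instance : IsUltrametricDist (BddEnd K V) :=
  IsUltrametricDist.isUltrametricDist_of_forall_norm_add_le_max_norm fun f g =>
    BddEnd.norm_le (le_max_of_le_left (norm_nonneg f)) fun v => by
      rw [max_mul_of_nonneg _ _ (norm_nonneg v)]
      exact (IsUltrametricDist.norm_add_le_max _ _).trans (max_le_max (f.le_norm v) (g.le_norm v))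

instance {ι : Type*} : IsUltrametricDist (lp (fun _ : ι => BddEnd K V) ⊤) :=
  IsUltrametricDist.isUltrametricDist_of_forall_norm_add_le_max_norm fun f g =>
    lp.norm_le_of_forall_le (le_max_of_le_left (norm_nonneg f)) fun i =>
      (IsUltrametricDist.norm_add_le_max (f i) (g i)).trans
        (max_le_max (lp.norm_apply_le_norm ENNReal.top_ne_zero f i)
          (lp.norm_apply_le_norm ENNReal.top_ne_zero g i))

instance : IsUltrametricDist (QField K V) :=
  IsUltrametricDist.isUltrametricDist_of_forall_norm_add_le_max_norm fun f g =>
    IsUltrametricDist.norm_add_le_max f.1 g.1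

theorem norm_sub_le_max {E : Type*} [SeminormedAddCommGroup E] [IsUltrametricDist E] (x y : E) :
    ‖x - y‖ ≤ max ‖x‖ ‖y‖ := by
  rw [sub_eq_add_neg, ← norm_neg y]
  exact IsUltrametricDist.norm_add_le_max x (-y)

variable [CompleteSpace V]

/-- The space of fields is complete in the form needed here: a sequence of fields tending to zero
in norm is summable, its sum being computed pointwise. -/
theorem QField.summable_of_tendsto_zero {F : ℕ → QField K V} (h : Tendsto F atTop (𝓝 0)) :
    Summable F := by
  have hn : Tendsto (fun j => ‖F j‖) atTop (𝓝 0) := by simpa using h.norm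
  obtain ⟨C, hC⟩ := hn.bddAbove_range
  have hC' : ∀ j, ‖F j‖ ≤ C := fun j => hC ⟨j, rfl⟩
  have hC0 : 0 ≤ C := (norm_nonneg _).trans (hC' 0)
  have hb : ∀ j (n : ℤ) v, ‖(F j).1 n v‖ ≤ C * ‖v‖ := fun j n v =>
    (apply_le (F j).1 n v).trans (mul_le_mul_of_nonneg_right (hC' j) (norm_nonneg v))
  have hs : ∀ (n : ℤ) v, Summable fun j => (F j).1 n v := fun n v =>
    summable_nat (squeeze_zero_norm (fun j => apply_le (F j).1 n v)
      (by simpa using hn.mul_const ‖v‖))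
  let S : Dist K V := mkDist (fun n => weakSum (fun j => (F j).1 n) ⟨C, hC0, fun j v => hb j n v⟩
    (hs n)) ⟨C, hC0, fun n v => weakSum_bound _ _ _ (by positivity) v fun j => hb j n v⟩
  have hS : ∀ n v, HasSum (fun j => (F j).1 n v) (S n v) := fun n v => (hs n v).hasSum
  have hbd : ∀ n v (c : ℝ), 0 ≤ c → (∀ j, ‖(F j).1 n v‖ ≤ c) → ‖S n v‖ ≤ c := fun n v c hc h =>
    IsUltrametricDist.norm_tsum_le_of_forall_le_of_nonneg hc h
  have hSf : S ∈ fields K V := by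
    intro v
    rw [Metric.tendsto_atTop]
    intro ε hε
    obtain ⟨N, hN⟩ := eventually_atTop.1
      ((show Tendsto (fun j => ‖F j‖ * ‖v‖) atTop (𝓝 0) by
        simpa using hn.mul_const ‖v‖).eventually_lt_const (half_pos hε))
    have hall : ∀ᶠ n : ℤ in atTop, ∀ j ∈ Finset.range N, ‖(F j).1 n v‖ < ε / 2 :=
      (Finset.eventually_all _).2 fun j _ => by
        have h2 := ((F j).2 v).norm
        rw [norm_zero] at h2
        exact h2.eventually_lt_const (half_pos hε)
    obtain ⟨P, hP⟩ := eventually_atTop.1 hall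
    refine ⟨P, fun n hnP => ?_⟩
    rw [dist_zero_right]
    refine lt_of_le_of_lt (hbd n v (ε / 2) (half_pos hε).le fun j => ?_)
      (half_lt_self hε)
    by_cases hj : j < N
    · exact (hP n hnP j (Finset.mem_range.2 hj)).le
    · exact (apply_le (F j).1 n v).trans (hN j (not_lt.1 hj)).le
  refine ⟨⟨S, hSf⟩, ?_⟩
  change Tendsto _ _ _
  rw [SummationFilter.unconditional_filter, Metric.tendsto_atTop]
  intro ε hε
  obtain ⟨N, hN⟩ := eventually_atTop.1 (hn.eventually_lt_const (half_pos hε))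
  refine ⟨Finset.range N, fun s hsN => ?_⟩
  rw [dist_comm, dist_eq_norm]
  refine lt_of_le_of_lt ?_ (half_lt_self hε)
  refine norm_le_of_apply_le (f := S - (∑ j ∈ s, F j : QField K V).1) (half_pos hε).le fun n v => ?_
  -- The tail of the pointwise sum is a limit of finite sums with indices outside `s`.
  have hlim : Tendsto (fun t : Finset ℕ => ∑ j ∈ t, (F j).1 n v - ∑ j ∈ s, (F j).1 n v) atTop
      (𝓝 (S n v - ∑ j ∈ s, (F j).1 n v)) := by
    have := hS n v
    rw [HasSum, SummationFilter.unconditional_filter] at this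
    exact this.sub_const _
  have e : (S - (∑ j ∈ s, F j : QField K V).1) n v = S n v - ∑ j ∈ s, (F j).1 n v := by
    change S n v - evalHom n v ((fields K V).subtype (∑ j ∈ s, F j)) = _
    rw [map_sum, map_sum]
    rfl
  rw [e]
  refine le_of_tendsto hlim.norm ?_
  filter_upwards [eventually_ge_atTop s] with t hst
  rw [← Finset.sum_sdiff hst, add_sub_cancel_right]
  refine IsUltrametricDist.norm_sum_le_of_forall_le_of_nonneg (by positivity) fun j hj => ?_
  have hjN : N ≤ j := by
    by_contra hlt
    exact (Finset.mem_sdiff.1 hj).2 (hsN (Finset.mem_range.2 (not_le.1 hlt)))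
  exact (apply_le (F j).1 n v).trans
    (mul_le_mul_of_nonneg_right (hN j hjN).le (norm_nonneg v))

end Norms

/-! ### Local distributions and their expansion in derivatives of the delta-function -/

section Local

variable {K V : Type*} [NormedCommRing K] [NormedAddCommGroup V] [Module K V] [IsBoundedSMul K V]

theorem mulSub_apply (f : Dist2 K V) (m k : ℤ) (v : V) :
    mulSub f (m, k) v = f (m + 1, k) v - f (m, k + 1) v := rfl

theorem norm_residue_le (f : Dist2 K V) : ‖residue f‖ ≤ ‖f‖ :=
  norm_le_of_apply_le (norm_nonneg f) fun _ v => apply_le f _ v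

/-- Multiplication by `(z - w)^N` as an additive map. -/
noncomputable def mulSubPow (N : ℕ) : Dist2 K V →+ Dist2 K V where
  toFun := mulSub^[N]
  map_zero' := Function.iterate_fixed (dist_ext fun _ _ => by simp [mulSub]) N
  map_add' f g := by
    induction N generalizing f g with
    | zero => rfl
    | succ N ih =>
      have h : mulSub (f + g) = mulSub f + mulSub g := dist_ext fun _ _ => by
        simp [mulSub]; abel
      rw [Function.iterate_succ_apply, h, ih]
      rfl

variable [IsUltrametricDist V]

/-- A distribution is controlled by the residues `Res_z (z-w)^j f` for `j < M` and by
`(z-w)^M f`. -/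
theorem norm_le_of_residue_le {ε : ℝ} (hε : 0 ≤ ε) (M : ℕ) (f : Dist2 K V)
    (hM : ‖mulSub^[M] f‖ ≤ ε) (hres : ∀ j < M, ‖residue (mulSub^[j] f)‖ ≤ ε) : ‖f‖ ≤ ε := by
  induction M generalizing f with
  | zero => exact hM
  | succ M ih =>
    have h1 : ‖mulSub f‖ ≤ ε := ih (mulSub f) hM fun j hj => hres (j + 1) (by omega)
    have h0 : ‖residue f‖ ≤ ε := hres 0 (by omega)
    -- `f (m + 1, k)` and `f (m, k + 1)` differ by a coefficient of `(z - w) f`, so that the bound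
    -- spreads from the row `m = 0` to all rows.
    have key : ∀ m k v, ‖f (m, k) v‖ ≤ ε * ‖v‖ := by
      have h1' : ∀ m k v, ‖mulSub f (m, k) v‖ ≤ ε * ‖v‖ := fun m k v =>
        (apply_le _ _ v).trans (mul_le_mul_of_nonneg_right h1 (norm_nonneg v))
      intro m
      induction m using Int.induction_on with
      | zero => exact fun k v =>
          (apply_le (residue f) k v).trans (mul_le_mul_of_nonneg_right h0 (norm_nonneg v))
      | succ i hi =>
        intro k v
        rw [← sub_add_cancel (f (i + 1, k) v) (f (i, k + 1) v)]
        exact (IsUltrametricDist.norm_add_le_max _ _).trans (max_le (h1' i k v) (hi (k + 1) v))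
      | pred i hi =>
        intro k v
        have e : f (-i - 1, k) v = f (-i, k - 1) v - mulSub f (-i - 1, k - 1) v := by
          rw [mulSub_apply, sub_add_cancel, sub_add_cancel, sub_sub_cancel]
        rw [e]
        exact (norm_sub_le_max _ _).trans (max_le (hi (k - 1) v) (h1' _ _ v))
    exact norm_le_of_apply_le hε fun i v => key i.1 i.2 v

/-- The coefficients of `g(w) ∂_w^{(j)} δ(z-w)`. -/
theorem mulSeries_derivW_delta_apply (g : Dist K V) (j : ℕ) (m k : ℤ) :
    mulSeries g (derivW j delta) (m, k) = Ring.choose m j • g (k + m - j) := by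
  change ∑ᶠ q : ℤ, derivW j delta (-m - 1, q) • g (k + q) = _
  rw [finsum_eq_single _ (m - j)]
  · simp [derivW, delta, add_sub_assoc, show -m - 1 + m = -1 by ring]
  · intro q hq
    have : ¬ (-m - 1 + (q + j) = -1) := by omega
    simp [derivW, delta, this]

theorem mulSub_mulSeries_zero (g : Dist K V) : mulSub (mulSeries g (derivW 0 delta)) = 0 :=
  dist_ext fun ⟨m, k⟩ v => by
    rw [mulSub_apply, mulSeries_derivW_delta_apply, mulSeries_derivW_delta_apply]
    simp [add_assoc, add_comm (1 : ℤ)]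

theorem mulSub_mulSeries_succ (g : Dist K V) (j : ℕ) :
    mulSub (mulSeries g (derivW (j + 1) delta)) = mulSeries g (derivW j delta) :=
  dist_ext fun ⟨m, k⟩ v => by
    rw [mulSub_apply]
    simp only [mulSeries_derivW_delta_apply, Ring.choose_succ_succ, BddEnd.zsmul_apply]
    rw [show k + (m + 1) - ((j + 1 : ℕ) : ℤ) = k + m - j by push_cast; ring,
      show k + 1 + m - ((j + 1 : ℕ) : ℤ) = k + m - j by push_cast; ring, add_smul,
      add_sub_cancel_right]

theorem iterate_mulSub_mulSeries_of_lt (g : Dist K V) {i j : ℕ} (h : j < i) :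
    mulSub^[i] (mulSeries g (derivW j delta)) = 0 := by
  induction j generalizing i with
  | zero =>
    obtain ⟨i, rfl⟩ : ∃ l, i = l + 1 := ⟨i - 1, by omega⟩
    rw [Function.iterate_succ_apply, mulSub_mulSeries_zero]
    exact map_zero (mulSubPow i)
  | succ j ih =>
    obtain ⟨i, rfl⟩ : ∃ l, i = l + 1 := ⟨i - 1, by omega⟩
    rw [Function.iterate_succ_apply, mulSub_mulSeries_succ]
    exact ih (by omega)

theorem iterate_mulSub_mulSeries_add (g : Dist K V) (i l : ℕ) :
    mulSub^[i] (mulSeries g (derivW (l + i) delta)) = mulSeries g (derivW l delta) := by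
  induction i with
  | zero => rfl
  | succ i ih => rw [Function.iterate_succ_apply, ← add_assoc, mulSub_mulSeries_succ, ih]

theorem residue_mulSeries (g : Dist K V) (l : ℕ) :
    residue (mulSeries g (derivW l delta)) = if l = 0 then g else 0 :=
  dist_ext fun k v => by
    change mulSeries g (derivW l delta) (0, k) v = _
    rw [mulSeries_derivW_delta_apply]
    cases l <;> simp

/-- `Res_z (z-w)^i` picks out the coefficient of `∂_w^{(i)} δ(z-w)`. -/
theorem residue_iterate_mulSub_mulSeries (g : Dist K V) (i j : ℕ) :
    residue (mulSub^[i] (mulSeries g (derivW j delta))) = if j = i then g else 0 := by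
  rcases lt_or_ge j i with h | h
  · rw [iterate_mulSub_mulSeries_of_lt g h, if_neg h.ne]
    rfl
  · obtain ⟨l, rfl⟩ := Nat.exists_eq_add_of_le' h
    rw [iterate_mulSub_mulSeries_add, residue_mulSeries]
    simp

/-- The operation `f ↦ Res_z (z-w)^i f` as an additive map. -/
noncomputable def residueHom (i : ℕ) : Dist2 K V →+ Dist K V where
  toFun f := residue (mulSub^[i] f)
  map_zero' := by
    rw [show mulSub^[i] (0 : Dist2 K V) = 0 from map_zero (mulSubPow i)]
    rfl
  map_add' f g := by
    rw [show mulSub^[i] (f + g) = mulSub^[i] f + mulSub^[i] g from map_add (mulSubPow i) f g]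
    rfl

/-- The decomposition theorem: a distribution `f` with `(z-w)^N f → 0` equals
`∑_j (Res_z (z-w)^j f)(w) ∂_w^{(j)} δ(z-w)`, the series converging in norm. -/
theorem hasSum_mulSeries_residue (f : Dist2 K V)
    (hf : Tendsto (fun N : ℕ => mulSub^[N] f) atTop (𝓝 0)) :
    HasSum (fun j : ℕ => mulSeries (residue (mulSub^[j] f)) (derivW j delta)) f := by
  rw [HasSum, SummationFilter.unconditional_filter, Metric.tendsto_atTop]
  intro ε hε
  obtain ⟨N, hN⟩ := Metric.tendsto_atTop.1 hf (ε / 2) (half_pos hε)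
  simp only [dist_zero_right] at hN
  refine ⟨Finset.range N, fun s hs => ?_⟩
  rw [dist_comm, dist_eq_norm]
  refine lt_of_le_of_lt ?_ (half_lt_self hε)
  -- Beyond all indices in `s`, the power of `z - w` kills every term of the partial sum.
  obtain ⟨M, hsM⟩ := s.exists_nat_subset_range
  refine norm_le_of_residue_le (half_pos hε).le (max N M) _ ?_ fun i _ => ?_
  · change ‖mulSubPow (max N M) _‖ ≤ _
    rw [map_sub, map_sum, Finset.sum_eq_zero, sub_zero]
    · exact (hN _ (le_max_left _ _)).le
    · exact fun j hj => iterate_mulSub_mulSeries_of_lt _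
        ((Finset.mem_range.1 (hsM hj)).trans_le (le_max_right _ _))
  · change ‖residueHom i _‖ ≤ _
    rw [map_sub, map_sum]
    simp only [residueHom, AddMonoidHom.coe_mk, ZeroHom.coe_mk, residue_iterate_mulSub_mulSeries,
      Finset.sum_ite_eq']
    split_ifs with hi
    · rw [sub_self, norm_zero]
      exact (half_pos hε).le
    · rw [sub_zero]
      refine (norm_residue_le _).trans (hN i ?_).le
      by_contra hlt
      exact hi (hs (Finset.mem_range.2 (not_le.1 hlt)))

end Local

end NAVertex

namespace NAVertex

/-! ### The two expansions of the product with a power of `z - w` -/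

section Expansion

variable {K V : Type*} [NormedCommRing K] [NormedAddCommGroup V] [Module K V] [IsBoundedSMul K V]
  [IsUltrametricDist V] [CompleteSpace V]

/-- The coefficients of `a(z) b(w) i_{z,w}((z-w)^n)` as convergent series. -/
theorem hasSum_prodZW (a b : QField K V) (n m k : ℤ) (v : V) :
    HasSum (fun j : ℕ => ((-1) ^ j * Ring.choose n j) • a.1 (m + n - j) (b.1 (k + j) v))
      (prodZW a b n (m, k) v) := by
  have he : Function.Injective fun j : ℕ => (n - j, (j : ℤ)) :=
    fun i j h => by simpa using (Prod.ext_iff.1 h).2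
  have hs : Summable fun j : ℕ =>
      ((-1) ^ j * Ring.choose n j) • a.1 (m + n - j) (b.1 (k + j) v) :=
    summable_nat (squeeze_zero_norm (fun j => IsUltrametricDist.norm_zsmul_le _ _) (by
      simpa using (tendsto_apply_zero a.1 (fun j : ℕ => m + n - j) (b.tendsto_nat_add k v)).norm))
  have e : prodZW a b n (m, k) v = ∑' pq : ℤ × ℤ,
      (expandZW n pq • (a.1 (m + pq.1)).comp (b.1 (k + pq.2))) v := rfl
  have h := (he.hasSum_iff (f := fun pq : ℤ × ℤ =>
      (expandZW n pq • (a.1 (m + pq.1)).comp (b.1 (k + pq.2))) v) (by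
    rintro ⟨p, q⟩ hx
    have : ¬ (0 ≤ q ∧ p + q = n) := by
      rintro ⟨h1, h2⟩
      exact hx ⟨q.toNat, Prod.ext (by simp; omega) (by simp; omega)⟩
    simp [expandZW, this])).1 (by
      convert hs.hasSum using 2 with j
      simp [expandZW, add_sub_assoc])
  rw [e, h.tsum_eq]
  exact hs.hasSum

/-- The coefficients of `b(w) a(z) i_{w,z}((z-w)^n)` as convergent series. -/
theorem hasSum_prodWZ (a b : QField K V) (n m k : ℤ) (v : V) :
    HasSum (fun j : ℕ => ((-1) ^ j * Ring.choose n j) •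
      ((Int.negOnePow n : ℤ) • b.1 (n + k - j) (a.1 (m + j) v))) (prodWZ a b n (m, k) v) := by
  have he : Function.Injective fun j : ℕ => ((j : ℤ), n - j) :=
    fun i j h => by simpa using (Prod.ext_iff.1 h).1
  have hs : Summable fun j : ℕ => ((-1) ^ j * Ring.choose n j) •
      ((Int.negOnePow n : ℤ) • b.1 (n + k - j) (a.1 (m + j) v)) :=
    summable_nat (squeeze_zero_norm (fun j => (IsUltrametricDist.norm_zsmul_le _ _).trans
      (IsUltrametricDist.norm_zsmul_le _ _)) (by
      simpa using (tendsto_apply_zero b.1 (fun j : ℕ => n + k - j) (a.tendsto_nat_add m v)).norm))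
  have e : prodWZ a b n (m, k) v = ∑' pq : ℤ × ℤ,
      (expandWZ n pq • (b.1 (k + pq.2)).comp (a.1 (m + pq.1))) v := rfl
  have h := (he.hasSum_iff (f := fun pq : ℤ × ℤ =>
      (expandWZ n pq • (b.1 (k + pq.2)).comp (a.1 (m + pq.1))) v) (by
    rintro ⟨p, q⟩ hx
    have : ¬ (0 ≤ p ∧ p + q = n) := by
      rintro ⟨h1, h2⟩
      exact hx ⟨p.toNat, Prod.ext (by simp; omega) (by simp; omega)⟩
    simp [expandWZ, this])).1 (by
      convert hs.hasSum using 2 with j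
      simp only [Function.comp, expandWZ, BddEnd.zsmul_apply, BddEnd.comp_apply, smul_smul]
      rw [if_pos ⟨by omega, by ring⟩, Int.toNat_natCast, show k + (n - (j : ℤ)) = n + k - j by ring,
        Int.negOnePow_sub, Int.negOnePow_def (j : ℤ)]
      push_cast
      simp only [zpow_natCast, Units.val_pow_eq_pow_val, Units.val_neg, Units.val_one]
      congr 1
      ring)
  rw [e, h.tsum_eq]
  exact hs.hasSum

/-- The two expansions are exchanged by swapping the fields, up to the sign `(-1)^n`. -/
theorem prodWZ_apply (a b : QField K V) (n m k : ℤ) (v : V) :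
    prodWZ a b n (m, k) v = (Int.negOnePow n : ℤ) • prodZW b a n (k, m) v := by
  refine (hasSum_prodWZ a b n m k v).unique ?_
  have h := (hasSum_prodZW b a n k m v).map (zsmulAddGroupHom (Int.negOnePow n : ℤ))
    (continuous_const_smul (Int.negOnePow n : ℤ))
  convert h using 1
  · funext j
    simp only [Function.comp, zsmulAddGroupHom_apply]
    rw [smul_comm, add_comm n k]
  · rfl

theorem norm_prodZW_le (a b : QField K V) (n : ℤ) : ‖prodZW a b n‖ ≤ ‖a‖ * ‖b‖ :=
  norm_le_of_apply_le (by positivity) fun _ v =>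
    IsUltrametricDist.norm_tsum_le_of_forall_le_of_nonneg (by positivity) fun _ =>
    (IsUltrametricDist.norm_zsmul_le _ _).trans (apply_apply_le a.1 b.1 _ _ v)

theorem norm_prodWZ_le (a b : QField K V) (n : ℤ) : ‖prodWZ a b n‖ ≤ ‖a‖ * ‖b‖ :=
  norm_le_of_apply_le (by positivity) fun _ v =>
    IsUltrametricDist.norm_tsum_le_of_forall_le_of_nonneg (by positivity) fun _ =>
    (IsUltrametricDist.norm_zsmul_le _ _).trans
      ((apply_apply_le b.1 a.1 _ _ v).trans_eq (by rw [mul_comm ‖b.1‖]; rfl))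

theorem mulSub_prodZW (a b : QField K V) (n : ℤ) : mulSub (prodZW a b n) = prodZW a b (n + 1) := by
  refine dist_ext fun ⟨m, k⟩ v => ?_
  rw [mulSub_apply]
  refine HasSum.unique ?_ (hasSum_prodZW a b (n + 1) m k v)
  have h1 := hasSum_prodZW a b n (m + 1) k v
  have h2 := hasSum_prodZW a b n m (k + 1) v
  -- After its term `j = 0` is split off, the first series is indexed by `j + 1` and pairs with the
  -- second one; Pascal's rule combines the coefficients.
  rw [← hasSum_nat_add_iff' 1] at h1
  rw [← hasSum_nat_add_iff' 1]
  convert h1.sub h2 using 1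
  · funext j
    rw [Ring.choose_succ_succ,
      show m + (n + 1) - ((j + 1 : ℕ) : ℤ) = m + n - j by push_cast; ring,
      show m + 1 + n - ((j + 1 : ℕ) : ℤ) = m + n - j by push_cast; ring,
      show k + 1 + (j : ℤ) = k + ((j + 1 : ℕ) : ℤ) by push_cast; ring, ← sub_smul]
    congr 1
    ring
  · simp [add_assoc, add_comm (1 : ℤ)]
    abel

theorem mulSub_prodWZ (a b : QField K V) (n : ℤ) : mulSub (prodWZ a b n) = prodWZ a b (n + 1) := by
  refine dist_ext fun ⟨m, k⟩ v => ?_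
  rw [mulSub_apply, prodWZ_apply, prodWZ_apply, prodWZ_apply, ← mulSub_prodZW, mulSub_apply,
    Int.negOnePow_succ, ← smul_sub, Units.val_neg, neg_smul, ← smul_neg, neg_sub]

/-- The distribution `a(z) b(w) i_{z,w}((z-w)^n) - b(w) a(z) i_{w,z}((z-w)^n)`, which extends
`(z-w)^n [a(z), b(w)]` to all integers `n`. -/
noncomputable def shiftedCommutator (a b : QField K V) (n : ℤ) : Dist2 K V :=
  prodZW a b n - prodWZ a b n

theorem norm_shiftedCommutator_le (a b : QField K V) (n : ℤ) :
    ‖shiftedCommutator a b n‖ ≤ ‖a‖ * ‖b‖ :=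
  (norm_sub_le_max _ _).trans
    (max_le (norm_prodZW_le a b n) (norm_prodWZ_le a b n))

theorem iterate_mulSub_shiftedCommutator (a b : QField K V) (n : ℤ) (j : ℕ) :
    mulSub^[j] (shiftedCommutator a b n) = shiftedCommutator a b (n + j) := by
  induction j with
  | zero => simp
  | succ j ih =>
    rw [Function.iterate_succ_apply', ih]
    change mulSubPow 1 (prodZW a b (n + j) - prodWZ a b (n + j)) = _
    rw [map_sub]
    change mulSub _ - mulSub _ = _
    rw [mulSub_prodZW, mulSub_prodWZ, Nat.cast_succ, ← add_assoc]
    rfl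

theorem prodZW_zero_apply (a b : QField K V) (m k : ℤ) (v : V) :
    prodZW a b 0 (m, k) v = a.1 m (b.1 k v) := by
  refine (hasSum_prodZW a b 0 m k v).unique ?_
  convert hasSum_single 0 fun j hj => ?_
  · simp
  · simp [Ring.choose_zero_pos ℤ (Nat.pos_of_ne_zero hj)]

theorem shiftedCommutator_zero (a b : QField K V) :
    shiftedCommutator a b 0 = commutator a.1 b.1 :=
  dist_ext fun ⟨m, k⟩ v => by
    change prodZW a b 0 (m, k) v - prodWZ a b 0 (m, k) v = _
    rw [prodWZ_apply, prodZW_zero_apply, prodZW_zero_apply]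
    simp [commutator]

/-- The coefficients of the expansion of `(z-w)^(-m-1)`. -/
theorem choose_negSucc (m j : ℕ) :
    (-1) ^ j * Ring.choose (Int.negSucc m) j = ((m + j).choose m : ℤ) := by
  rw [Int.negSucc_eq, Ring.choose_neg, show ((m : ℤ) + 1 + j - 1) = ((m + j : ℕ) : ℤ) by
    push_cast; ring, Ring.choose_natCast, Nat.choose_symm_add, Int.negOnePow_def, Units.smul_def]
  simp only [zpow_natCast, Units.val_pow_eq_pow_val, Units.val_neg, Units.val_one, smul_eq_mul]
  rw [← mul_assoc, ← mul_pow]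
  simp

/-- For `n = -m-1` the residue of `a(z) b(w) i_{z,w}((z-w)^n)` is `(∂^{(m)} a)_+ b`. -/
theorem plusCoeff_derivation_apply (a b : QField K V) (m : ℕ) (k : ℤ) (v : V) :
    plusCoeff (a.derivation m) b k v = prodZW a b (Int.negSucc m) (0, k) v := by
  refine HasSum.unique ?_ (hasSum_prodZW a b (Int.negSucc m) 0 k v)
  have hs : Summable fun i : ℕ => (a.derivation m).1 (-1 - i) (b.1 (k + i) v) :=
    summable_nat (tendsto_apply_zero _ _ (b.tendsto_nat_add k v))
  have hs' : HasSum (fun i : ℕ => (a.derivation m).1 (-1 - i) (b.1 (k + i) v))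
      (plusCoeff (a.derivation m) b k v) := hs.hasSum
  convert hs' using 2 with i
  rw [choose_negSucc]
  simp only [QField.derivation, derivation, mkDist_apply, BddEnd.zsmul_apply]
  rw [show (m : ℤ) - (-1 - i) - 1 = ((m + i : ℕ) : ℤ) by push_cast; ring, Ring.choose_natCast,
    show (-1 : ℤ) - i - m = 0 + Int.negSucc m - i by rw [Int.negSucc_eq]; ring]

/-- For `n = -m-1` the residue of `-b(w) a(z) i_{w,z}((z-w)^n)` is `b (∂^{(m)} a)_-`. -/
theorem minusCoeff_derivation_apply (a b : QField K V) (m : ℕ) (k : ℤ) (v : V) :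
    minusCoeff (a.derivation m) b k v = -prodWZ a b (Int.negSucc m) (0, k) v := by
  refine HasSum.unique ?_ (hasSum_prodWZ a b (Int.negSucc m) 0 k v).neg
  have hs : Summable fun i : ℕ => b.1 (k - 1 - i) ((a.derivation m).1 i v) :=
    summable_nat (tendsto_apply_zero _ _ (by simpa using (a.derivation m).tendsto_nat_add 0 v))
  have hs' : HasSum (fun i : ℕ => b.1 (k - 1 - i) ((a.derivation m).1 i v))
      (minusCoeff (a.derivation m) b k v) := hs.hasSum
  -- The first `m` terms vanish, since `∂^{(m)}` kills the powers `z^0, …, z^(m-1)`.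
  rw [← hasSum_nat_add_iff' m, Finset.sum_eq_zero, sub_zero] at hs'
  · convert hs' using 2 with i
    simp only [QField.derivation, derivation, mkDist_apply, BddEnd.zsmul_apply]
    rw [choose_negSucc, show (m : ℤ) - ((i + m : ℕ) : ℤ) - 1 = -((i : ℤ) + 1) by push_cast; ring,
      Ring.choose_neg, show (i : ℤ) + 1 + m - 1 = ((m + i : ℕ) : ℤ) by push_cast; ring,
      Ring.choose_natCast, show k - 1 - ((i + m : ℕ) : ℤ) = Int.negSucc m + k - i by
        rw [Int.negSucc_eq]; push_cast; ring,
      show ((i + m : ℕ) : ℤ) - m = 0 + i by push_cast; ring, map_zsmul, Units.smul_def, smul_smul,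
      ← neg_smul, Int.negSucc_eq, Int.negOnePow_neg, Int.negOnePow_succ, smul_eq_mul, Units.val_neg]
    congr 1
    ring
  · intro i hi
    have hi' := Finset.mem_range.1 hi
    simp only [QField.derivation, derivation, mkDist_apply, BddEnd.zsmul_apply]
    rw [show (m : ℤ) - i - 1 = ((m - i - 1 : ℕ) : ℤ) by omega, Ring.choose_natCast,
      Nat.choose_eq_zero_of_lt (by omega)]
    simp

/-- The `n`-th product is `Res_z` of the shifted commutator, uniformly in `n ∈ ℤ`. -/
theorem nthProd_eq_residue (a b : QField K V) (n : ℤ) :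
    (nthProd n a b).1 = residue (shiftedCommutator a b n) := by
  cases n with
  | ofNat n =>
    have h := iterate_mulSub_shiftedCommutator a b 0 n
    rw [shiftedCommutator_zero, zero_add] at h
    change residue (mulSub^[n] (commutator a.1 b.1)) = _
    rw [h]
    rfl
  | negSucc m =>
    refine dist_ext fun k v => ?_
    change plusCoeff (a.derivation m) b k v + minusCoeff (a.derivation m) b k v =
      prodZW a b (Int.negSucc m) (0, k) v - prodWZ a b (Int.negSucc m) (0, k) v
    rw [plusCoeff_derivation_apply, minusCoeff_derivation_apply, sub_eq_add_neg]

theorem norm_nthProd_le (a b : QField K V) (n : ℤ) : ‖nthProd n a b‖ ≤ ‖a‖ * ‖b‖ := by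
  change ‖(nthProd n a b).1‖ ≤ _
  rw [nthProd_eq_residue]
  exact (norm_residue_le _).trans (norm_shiftedCommutator_le a b n)

theorem tendsto_shiftedCommutator {a b : QField K V} (h : MutuallyLocal a.1 b.1) (n : ℤ) :
    Tendsto (fun j : ℕ => shiftedCommutator a b (n + j)) atTop (𝓝 0) := by
  have h0 : Tendsto (fun N : ℕ => shiftedCommutator a b N) atTop (𝓝 0) := by
    refine Tendsto.congr (fun N => ?_) h
    rw [← shiftedCommutator_zero, iterate_mulSub_shiftedCommutator, zero_add]
  rw [← tendsto_add_atTop_iff_nat (-n).toNat]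
  refine (h0.comp (tendsto_add_atTop_nat (n + (-n).toNat).toNat)).congr fun j => ?_
  simp only [Function.comp]
  congr 1
  omega

/-- High products of mutually local fields tend to zero in norm. -/
theorem tendsto_nthProd {a b : QField K V} (h : MutuallyLocal a.1 b.1) (n : ℤ) :
    Tendsto (fun j : ℕ => nthProd (n + j) a b) atTop (𝓝 0) := by
  refine squeeze_zero_norm (fun j => ?_) (by simpa using (tendsto_shiftedCommutator h n).norm)
  change ‖(nthProd (n + j) a b).1‖ ≤ _
  rw [nthProd_eq_residue]
  exact norm_residue_le _

/-- The operator product expansion of two mutually local fields. -/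
theorem hasSum_operatorProduct {a b : QField K V} (h : MutuallyLocal a.1 b.1) (n : ℤ) :
    HasSum (fun j : ℕ => mulSeries (nthProd (n + j) a b).1 (derivW j delta))
      (prodZW a b n - prodWZ a b n) := by
  have h1 := hasSum_mulSeries_residue (shiftedCommutator a b n) (by
    simpa only [iterate_mulSub_shiftedCommutator] using tendsto_shiftedCommutator h n)
  simp only [iterate_mulSub_shiftedCommutator, ← nthProd_eq_residue] at h1
  exact h1

end Expansion

/-! ### The Borcherds identity in a vertex algebra -/

namespace VertexAlgebra

variable {K V : Type*} [NormedCommRing K] [NormedAddCommGroup V] [Module K V] [IsBoundedSMul K V]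
  [IsUltrametricDist V] [CompleteSpace V] (A : VertexAlgebra K V)

theorem fs_fieldProd (n : ℤ) (φ ψ : A.Fld) : A.fs (A.fieldProd n φ ψ) = φ.1.1 n (A.fs ψ) :=
  nthProd_vac φ.1 ψ.1 A.vac (A.vacuum _ φ.2) (A.vacuum _ ψ.2) n

theorem continuous_fs : Continuous A.fs :=
  AddMonoidHomClass.continuous_of_bound _ ‖A.vac‖ fun φ => by
    rw [mul_comm]; exact apply_le φ.1.1 (-1) A.vac

theorem summable_of_tendsto_zero {F : ℕ → A.Fld} (h : Tendsto F atTop (𝓝 0)) : Summable F := by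
  have h' : Tendsto (fun j => (F j).1) atTop (𝓝 0) := (continuous_subtype_val.tendsto 0).comp h
  obtain ⟨s, hs⟩ := QField.summable_of_tendsto_zero h'
  have hmem : s ∈ A.Fld := A.isClosed_Fld.mem_of_tendsto hs
    (Eventually.of_forall fun t => A.Fld.sum_mem fun j _ => (F j).2)
  refine ⟨⟨s, hmem⟩, ?_⟩
  rw [HasSum, tendsto_subtype_rng]
  simpa [HasSum] using hs

theorem norm_fieldProd_le (n : ℤ) (φ ψ : A.Fld) : ‖A.fieldProd n φ ψ‖ ≤ ‖φ‖ * ‖ψ‖ :=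
  norm_nthProd_le φ.1 ψ.1 n

theorem tendsto_fieldProd (φ ψ : A.Fld) (n : ℤ) :
    Tendsto (fun j : ℕ => A.fieldProd (n + j) φ ψ) atTop (𝓝 0) :=
  tendsto_subtype_rng.2 (tendsto_nthProd (A.locality _ φ.2 _ ψ.2) n)

variable [IsAddTorsionFree V]

/-- The Borcherds identity for the fields of a vertex algebra. Both sums converge in norm because
`Fld(V)` is complete and high products of local fields tend to zero; they agree because a field
is determined by the vector it creates from the vacuum. -/
theorem exists_hasSum_borcherds (φ ψ χ : A.Fld) (m n k : ℤ) : ∃ s : A.Fld,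
    HasSum (fun j : ℕ => Ring.choose m j •
      A.fieldProd (m + k - j) (A.fieldProd (n + j) φ ψ) χ) s ∧
    HasSum (fun j : ℕ => ((-1) ^ j * Ring.choose n j) •
      (A.fieldProd (m + n - j) φ (A.fieldProd (k + j) ψ χ) -
        (Int.negOnePow n : ℤ) • A.fieldProd (n + k - j) ψ (A.fieldProd (m + j) φ χ))) s := by
  have hl : Summable fun j : ℕ => Ring.choose m j •
      A.fieldProd (m + k - j) (A.fieldProd (n + j) φ ψ) χ := by
    refine A.summable_of_tendsto_zero (squeeze_zero_norm (fun j =>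
      (IsUltrametricDist.norm_zsmul_le _ _).trans (A.norm_fieldProd_le _ _ _)) ?_)
    have h := (A.tendsto_fieldProd φ ψ n).norm.mul_const ‖χ‖
    rw [norm_zero, zero_mul] at h
    exact h
  have hr : Summable fun j : ℕ => ((-1) ^ j * Ring.choose n j) •
      (A.fieldProd (m + n - j) φ (A.fieldProd (k + j) ψ χ) -
        (Int.negOnePow n : ℤ) • A.fieldProd (n + k - j) ψ (A.fieldProd (m + j) φ χ)) := by
    refine A.summable_of_tendsto_zero (squeeze_zero_norm (a := fun j : ℕ =>
      ‖φ‖ * ‖A.fieldProd (k + j) ψ χ‖ + ‖ψ‖ * ‖A.fieldProd (m + j) φ χ‖) (fun j =>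
      (IsUltrametricDist.norm_zsmul_le _ _).trans ((norm_sub_le _ _).trans
        (add_le_add (A.norm_fieldProd_le _ _ _)
          ((IsUltrametricDist.norm_zsmul_le _ _).trans (A.norm_fieldProd_le _ _ _))))) ?_)
    have h := ((A.tendsto_fieldProd ψ χ k).norm.const_mul ‖φ‖).add
      ((A.tendsto_fieldProd φ χ m).norm.const_mul ‖ψ‖)
    rw [norm_zero, mul_zero, mul_zero, add_zero] at h
    exact h
  obtain ⟨s, hs⟩ := hl
  obtain ⟨t, ht⟩ := hr
  -- Both sums create the same vector from the vacuum, namely a coefficient of the operator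
  -- product expansion of `φ` and `ψ` applied to `χ_(-1)|0⟩`.
  have hs' := hs.map A.fs A.continuous_fs
  have ht' := ht.map A.fs A.continuous_fs
  have h1 := (hasSum_operatorProduct (A.locality _ φ.2 _ ψ.2) n).map
    (evalHom (m, k) (A.fs χ)) (continuous_evalHom _ _)
  have h2 := (hasSum_prodZW φ.1 ψ.1 n m k (A.fs χ)).sub (hasSum_prodWZ φ.1 ψ.1 n m k (A.fs χ))
  have es : A.fs s = evalHom (m, k) (A.fs χ) (prodZW φ.1 ψ.1 n - prodWZ φ.1 ψ.1 n) := by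
    refine hs'.unique ?_
    convert h1 using 1
    funext j
    simp only [Function.comp, map_zsmul, fs_fieldProd]
    change _ = mulSeries _ _ (m, k) (A.fs χ)
    rw [mulSeries_derivW_delta_apply, BddEnd.zsmul_apply, add_comm k m]
    rfl
  have et : A.fs t = evalHom (m, k) (A.fs χ) (prodZW φ.1 ψ.1 n - prodWZ φ.1 ψ.1 n) := by
    refine ht'.unique ?_
    convert h2 using 1
    · funext j
      simp only [Function.comp, map_zsmul, map_sub, fs_fieldProd, smul_sub]
    · rfl
  obtain rfl : s = t := A.fs_injective (es.trans et.symm)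
  exact ⟨s, hs, ht⟩

/-- The state-field correspondence turns products of states into products of fields. -/
theorem Y_stateProd (n : ℤ) (a b : A.stateImage) :
    A.Y (A.stateProd n a b) = A.fieldProd n (A.Y a) (A.Y b) := by
  refine A.fs_injective ?_
  rw [fs_fieldProd]
  change (A.Y (A.stateProd n a b)).1.1 (-1) A.vac = (A.Y a).1.1 n ((A.Y b).1.1 (-1) A.vac)
  rw [A.Y_vac, A.Y_vac]
  rfl

theorem continuous_Y_symm : Continuous A.Y.symm :=
  A.continuous_fs.subtype_mk _

end VertexAlgebra

end NAVertex

theorem mainTheorem2 {K V : Type*}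
    [NormedCommRing K] [IsUltrametricDist K] [CompleteSpace K] [IsAddTorsionFree K]
    [NormedAddCommGroup V] [IsUltrametricDist V] [CompleteSpace V] [IsAddTorsionFree V]
    [Module K V] [IsBoundedSMul K V] (A : VertexAlgebra K V) :
    (∀ (a b : A.stateImage) (n : ℤ),
      HasSum (fun j : ℕ => mulSeries (A.Y (A.stateProd (n + j) a b)).1.1 (derivW j delta))
        (prodZW (A.Y a).1 (A.Y b).1 n - prodWZ (A.Y a).1 (A.Y b).1 n)) ∧
    (∀ (a b c : A.stateImage) (m n k : ℤ), ∃ s : A.stateImage,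
      HasSum (fun j : ℕ => Ring.choose m j •
        A.stateProd (m + k - j) (A.stateProd (n + j) a b) c) s ∧
      HasSum (fun j : ℕ => ((-1) ^ j * Ring.choose n j) •
        (A.stateProd (m + n - j) a (A.stateProd (k + j) b c) -
          (Int.negOnePow n : ℤ) • A.stateProd (n + k - j) b (A.stateProd (m + j) a c))) s) ∧
    (∀ (a b c : A.Fld) (m n k : ℤ), ∃ s : A.Fld,
      HasSum (fun j : ℕ => Ring.choose m j •
        A.fieldProd (m + k - j) (A.fieldProd (n + j) a b) c) s ∧
      HasSum (fun j : ℕ => ((-1) ^ j * Ring.choose n j) •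
        (A.fieldProd (m + n - j) a (A.fieldProd (k + j) b c) -
          (Int.negOnePow n : ℤ) • A.fieldProd (n + k - j) b (A.fieldProd (m + j) a c))) s) := by
  refine ⟨fun a b n => ?_, fun a b c m n k => ?_, A.exists_hasSum_borcherds⟩
  · simp only [A.Y_stateProd]
    exact hasSum_operatorProduct (A.locality _ (A.Y a).2 _ (A.Y b).2) n
  · -- The field-state map carries the identity for fields to the one for states.
    obtain ⟨s, hl, hr⟩ := A.exists_hasSum_borcherds (A.Y a) (A.Y b) (A.Y c) m n k
    refine ⟨A.Y.symm s, ?_, ?_⟩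
    · convert hl.map A.Y.symm A.continuous_Y_symm using 2 with j
      simp only [Function.comp, map_zsmul, ← A.Y_stateProd, LinearEquiv.symm_apply_apply]
    · convert hr.map A.Y.symm A.continuous_Y_symm using 2 with j
      simp only [Function.comp, map_zsmul, map_sub, ← A.Y_stateProd,
        LinearEquiv.symm_apply_apply]
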